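/- For a positive integer $m$, let $N(m)$ denote the number of isomorphism classes of commutative (associative) rings with $1$ having exactly $m$ elements. There exists a real constant $C$ such that for every prime $p$ and every integer $n \ge 0$, $$p^{\frac{2}{27}n^3 - C n^{8/3}} \;\le\; N(p^n) \;\le\; p^{\frac{2}{27}n^3 + C n^{8/3}}.$$ In other words, the number of commutative rings of order $p^n$ up to isomorphism is $p^{\frac{2}{27}n^3 + O(n^{8/3})}$ as $n \to \infty$, where the implied constant can be chosen independent of $p$. -/

import Mathlib

/-- Isomorphism of rings, as an equivalence relation on the commutative rings with `1`
that have exactly `m` elements. -/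
def commRingIsoSetoid (m : ℕ) : Setoid {R : CommRingCat.{0} // Nat.card R = m} where
  r R S := Nonempty (R.1 ≃+* S.1)
  iseqv :=
    { refl := fun R => ⟨RingEquiv.refl R.1⟩
      symm := fun ⟨e⟩ => ⟨e.symm⟩
      trans := fun ⟨e⟩ ⟨f⟩ => ⟨e.trans f⟩ }

/-- The number of commutative rings with `1` of order `m`, up to isomorphism. -/
noncomputable def numCommRings (m : ℕ) : ℕ :=
  Nat.card (Quotient (commRingIsoSetoid m))

/-! Upper bound. Let `R` have order `p ^ n` and nilradical `J`. Two economies make the count sharp.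
The reduced ring `R / J` is a product of at most `n` finite fields and is generated by `O(√n)`
elements (`IsReduced.exists_finset_closure_eq_top`). Also `J² = X J` for some `X ⊆ J` with `O(√n)`
elements (`Ideal.exists_finset_span_mul_eq`). Let `S` be the subring generated by `X` and lifts of
the generators of `R / J`. By nilpotence, `J` is generated over `S` by lifts `y₁, …, y_d` of
generators of `J / J²`, where `p ^ d |J²| ≤ p ^ n`. The ring is then determined by its additive
group, `1`, `O(√n)` endomorphisms, the `yᵢ`, and the `d(d+1)/2` products `yᵢ yⱼ`, which lie in the
group `J²` of order at most `p ^ (n - d)`. Everything but the products costs `p ^ O(n^(5/2))`; the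
products cost `p ^ ((n - d) d (d + 1) / 2)`, whose exponent is largest near `d = 2n/3`, with value
`2n³/27 + O(n²)`.

Lower bound. Symmetric bilinear maps `β : V × V → W` over `ZMod p`, with `dim V = d ≈ 2n/3` and `dim
W = r = n - 1 - d`, give rings `F ⊕ V ⊕ W`. There are `p ^ (r d (d + 1) / 2)` of them. Inside a
fixed ring, `β` is recovered from the images of the `d + r` basis vectors, so each isomorphism class
occurs at most `p ^ (n(n - 1))` times. -/

/-! ### Submodules of modules of prime power order. -/

theorem Submodule.prime_mul_card_le {A M : Type*} [Ring A] [AddCommGroup M] [Module A M]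
    [Finite M] {p n : ℕ} (hp : p.Prime) (hM : Nat.card M = p ^ n) {N P : Submodule A M}
    (h : N < P) : p * Nat.card N ≤ Nat.card P := by
  have h1 : Nat.card N ∣ Nat.card P := by
    have := AddSubgroup.card_dvd_of_le (H := N.toAddSubgroup) (K := P.toAddSubgroup) h.le
    exact this
  have h2 : Nat.card P ∣ p ^ n := by
    rw [← hM]; exact AddSubgroup.card_addSubgroup_dvd_card P.toAddSubgroup
  obtain ⟨b, -, hb⟩ := (Nat.dvd_prime_pow hp).1 h2
  obtain ⟨a, hab, ha⟩ := (Nat.dvd_prime_pow hp).1 (hb ▸ h1)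
  have hne : a ≠ b := by
    rintro rfl
    have := AddSubgroup.eq_of_le_of_card_ge (H := N.toAddSubgroup) (K := P.toAddSubgroup) h.le
      (by change Nat.card P ≤ Nat.card N; omega)
    exact h.ne (Submodule.toAddSubgroup_injective this)
  rw [ha, hb, ← pow_succ']
  exact Nat.pow_le_pow_right hp.pos (by omega)

theorem Submodule.card_le_of_le {A M : Type*} [Ring A] [AddCommGroup M] [Module A M]
    [Finite M] {N P : Submodule A M} (h : N ≤ P) : Nat.card N ≤ Nat.card P :=
  Nat.card_le_card_of_injective _ (Submodule.inclusion_injective h)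

/-- A submodule `P ≥ N` of a finite module of `p`-power order is generated over `N` by at most
`log_p (|P| / |N|)` elements. -/
theorem Submodule.exists_fin_generators {A M : Type*} [Ring A] [AddCommGroup M] [Module A M]
    [Finite M] {p n : ℕ} (hp : p.Prime) (hM : Nat.card M = p ^ n) (P N : Submodule A M)
    (h : N ≤ P) : ∃ (d : ℕ) (y : Fin d → M), N ⊔ Submodule.span A (Set.range y) = P ∧
      p ^ d * Nat.card N ≤ Nat.card P := by
  induction N using WellFoundedGT.induction with
  | ind N ih =>
    rcases h.eq_or_lt with rfl | hlt
    · exact ⟨0, Fin.elim0, by simp, by simp⟩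
    · obtain ⟨y₀, hyP, hyN⟩ := SetLike.exists_of_lt hlt
      have hlt' : N < N ⊔ Submodule.span A {y₀} := by
        refine lt_of_le_of_ne le_sup_left fun he => hyN ?_
        rw [he]
        exact Submodule.mem_sup_right (Submodule.mem_span_singleton_self _)
      obtain ⟨d, y, hy, hd⟩ := ih _ hlt' (sup_le h (by simpa using hyP))
      refine ⟨d + 1, Fin.cons y₀ y, ?_, ?_⟩
      · rw [Fin.range_cons, Set.insert_eq, Submodule.span_union, ← sup_assoc, hy]
      · have := Submodule.prime_mul_card_le hp hM hlt'
        calc p ^ (d + 1) * Nat.card N = p ^ d * (p * Nat.card N) := by ring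
          _ ≤ p ^ d * _ := Nat.mul_le_mul_left _ this
          _ ≤ _ := hd

/-! ### Writing the square of an ideal with few multipliers. -/

/-- If `x₀, x₁, …` are such that `J x i` is not contained in the ideal `I i`, then some single
`c ∈ J` has a large multiple `c J` modulo `I 0`. -/
theorem Ideal.exists_card_sup_span_mul_ge {R : Type*} [CommRing R] [Finite R] {p n : ℕ}
    (hp : p.Prime) (hR : Nat.card R = p ^ n) (J : Ideal R) (I : ℕ → Ideal R) (hI : Monotone I)
    (x : ℕ → R) (q : ℕ) (hxJ : ∀ i < 2 * q, x i ∈ J)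
    (hxI : ∀ i < 2 * q, ∀ c ∈ J, c * x i ∈ I (i + 1))
    (hne : ∀ i < 2 * q, ∃ c ∈ J, c * x i ∉ I i) :
    ∃ c ∈ J, p ^ q * Nat.card (I 0) ≤ Nat.card (I 0 ⊔ Ideal.span {c} * J : Ideal R) := by
  classical
  have := Fintype.ofFinite R
  let JF : Finset R := Finset.univ.filter (· ∈ J)
  have hJF : JF.card = Nat.card J := by
    rw [Nat.card_eq_fintype_card, Fintype.card_subtype]
  let T : R → Finset ℕ := fun c => (Finset.range (2 * q)).filter fun i => c * x i ∉ I i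
  -- Averaging over `c ∈ J`: each of the `2 * q` indices is good for at least half of `J`, so some
  -- `c` is good for at least `q` indices.
  obtain ⟨c, hcJ, hc⟩ : ∃ c ∈ JF, 2 * q ≤ 2 * (T c).card := by
    refine Finset.exists_le_of_sum_le (f := fun _ => 2 * q) (g := fun c => 2 * (T c).card)
      ⟨0, by simp [JF]⟩ ?_
    have hswap : ∑ c ∈ JF, (T c).card =
        ∑ i ∈ Finset.range (2 * q), (JF.filter fun c => c * x i ∉ I i).card := by
      simp only [T, Finset.card_filter]
      exact Finset.sum_comm
    rw [← Finset.mul_sum JF (fun c => (T c).card), hswap, Finset.mul_sum, Finset.sum_const,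
      smul_eq_mul]
    have hterm : ∀ i ∈ Finset.range (2 * q),
        JF.card ≤ 2 * (JF.filter fun c => c * x i ∉ I i).card := by
      intro i hi
      rw [Finset.mem_range] at hi
      -- The bad `c` form a proper subideal of `J`, of index at least `p ≥ 2`.
      let D : Ideal R := J ⊓ Submodule.comap (LinearMap.mulRight R (x i)) (I i)
      have hD : D < J := by
        refine lt_of_le_of_ne inf_le_left fun he => ?_
        obtain ⟨c, hc, hcI⟩ := hne i hi
        rw [← he] at hc
        exact hcI hc.2
      have h1 := Submodule.prime_mul_card_le hp hR hD
      have h2 : (JF.filter fun c => c * x i ∈ I i).card = Nat.card D := by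
        rw [Nat.card_eq_fintype_card, Fintype.card_subtype, Finset.filter_filter]
        congr 1
        ext a
        simp [D]
      have h3 := Finset.card_filter_add_card_filter_not (s := JF) (fun c => c * x i ∈ I i)
      have h4 := Nat.mul_le_mul_right (Nat.card D) hp.two_le
      omega
    calc JF.card * (2 * q) = ∑ i ∈ Finset.range (2 * q), JF.card := by simp [mul_comm]
      _ ≤ _ := Finset.sum_le_sum hterm
  have hcJ : c ∈ J := by simpa [JF] using hcJ
  refine ⟨c, hcJ, ?_⟩
  set K : Ideal R := I 0 ⊔ Ideal.span {c} * J with hK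
  -- At a good index `i`, the element `c * x i` lies in `K ⊓ I (i + 1)` but not in `I i`, so the
  -- chain `K ⊓ I k` grows there by a factor of at least `p`.
  have key : ∀ k ≤ 2 * q, p ^ ((Finset.range k).filter fun i => c * x i ∉ I i).card *
      Nat.card (I 0) ≤ Nat.card (K ⊓ I k : Ideal R) := by
    intro k
    induction k with
    | zero =>
      intro _
      simp only [Finset.range_zero, Finset.filter_empty, Finset.card_empty, pow_zero, one_mul]
      exact Submodule.card_le_of_le (le_inf le_sup_left le_rfl)
    | succ k ih =>
      intro hk
      have ih := ih (by omega)
      have hle : K ⊓ I k ≤ K ⊓ I (k + 1) := inf_le_inf_left _ (hI (Nat.le_succ k))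
      rw [Finset.range_add_one, Finset.filter_insert]
      by_cases hcx : c * x k ∉ I k
      · rw [if_pos hcx, Finset.card_insert_of_notMem (by simp)]
        have hlt : K ⊓ I k < K ⊓ I (k + 1) := by
          refine lt_of_le_of_ne hle fun he => hcx ?_
          have : c * x k ∈ K ⊓ I (k + 1) :=
            ⟨Submodule.mem_sup_right (Ideal.mul_mem_mul (Ideal.mem_span_singleton_self c)
              (hxJ k (by omega))), hxI k (by omega) c hcJ⟩
          rw [← he] at this
          exact this.2
        have := Submodule.prime_mul_card_le hp hR hlt
        calc _ = p * (p ^ ((Finset.range k).filter fun i => c * x i ∉ I i).card *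
              Nat.card (I 0)) := by ring
          _ ≤ p * _ := Nat.mul_le_mul_left _ ih
          _ ≤ _ := this
      · rw [if_neg hcx]
        exact ih.trans (Submodule.card_le_of_le hle)
  calc p ^ q * Nat.card (I 0) ≤ p ^ (T c).card * Nat.card (I 0) :=
        Nat.mul_le_mul_right _ (Nat.pow_le_pow_right hp.pos (by omega))
    _ ≤ _ := key (2 * q) le_rfl
    _ ≤ _ := Submodule.card_le_of_le inf_le_left

/-- The square of an ideal `J` of a ring of order `p ^ n` is of the form `(x₁, …, xₛ) J` with
`s = O(√n)` elements `xᵢ ∈ J`. -/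
theorem Ideal.exists_finset_span_mul_eq {R : Type*} [CommRing R] [Finite R] {p n : ℕ}
    (hp : p.Prime) (hR : Nat.card R = p ^ n) (J : Ideal R) {q : ℕ} (hq : 0 < q)
    (hn : n ≤ q * q) :
    ∃ X : Finset R, (X : Set R) ⊆ J ∧ X.card ≤ 3 * q ∧ J * J ≤ Ideal.span (X : Set R) * J := by
  classical
  have := Fintype.ofFinite R
  let F : Finset (Finset R) := Finset.univ.filter fun X =>
    (X : Set R) ⊆ J ∧ p ^ (q * X.card) ≤ Nat.card (Ideal.span (X : Set R) * J : Ideal R)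
  -- Take a largest `X` in which every element pays for a factor `p ^ q` of `|X J|`. Since `n ≤ q *
  -- q`, it has at most `q` elements.
  obtain ⟨X, hXF, hXmax⟩ := Finset.exists_max_image F Finset.card
    ⟨∅, by simp [F]⟩
  simp only [F, Finset.mem_filter, Finset.mem_univ, true_and] at hXF hXmax
  obtain ⟨hXJ, hXcard⟩ := hXF
  have hXq : X.card ≤ q := by
    have h1 : Nat.card (Ideal.span (X : Set R) * J : Ideal R) ≤ p ^ n :=
      hR ▸ Finite.card_subtype_le _
    have h2 := (Nat.pow_le_pow_iff_right hp.one_lt).1 (hXcard.trans h1)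
    exact Nat.le_of_mul_le_mul_left (h2.trans hn) hq
  by_contra! hcon
  -- If no set of `3 * q` elements works, then `X` can be enlarged greedily `2 * q` times. The
  -- implications make the choice of `x` total, with value `0` for irrelevant `Y`.
  have hex : ∀ Y : Finset R, ∃ x, (Y : Set R) ⊆ J → Y.card ≤ 2 * q →
      x ∈ J ∧ ∃ c ∈ J, c * x ∉ Ideal.span ((X ∪ Y : Finset R) : Set R) * J := by
    intro Y
    by_cases hY : (Y : Set R) ⊆ J ∧ Y.card ≤ 2 * q
    · have h1 := hcon (X ∪ Y) (by simpa using ⟨hXJ, hY.1⟩)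
        ((Finset.card_union_le _ _).trans (by omega))
      rw [Ideal.mul_le] at h1
      push Not at h1
      obtain ⟨c, hc, x, hx, h⟩ := h1
      exact ⟨x, fun _ _ => ⟨hx, c, hc, h⟩⟩
    · exact ⟨0, fun h1 h2 => absurd ⟨h1, h2⟩ hY⟩
  choose f hf using hex
  let Y : ℕ → Finset R := fun k =>
    Nat.rec (motive := fun _ => Finset R) ∅ (fun _ Y => insert (f Y) Y) k
  have hYs : ∀ k, Y (k + 1) = insert (f (Y k)) (Y k) := fun k => rfl
  have hY : ∀ k ≤ 2 * q, (Y k : Set R) ⊆ J ∧ (Y k).card ≤ k := by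
    intro k
    induction k with
    | zero => intro _; simp [Y]
    | succ k ih =>
      intro hk
      obtain ⟨h1, h2⟩ := ih (by omega)
      refine ⟨?_, ?_⟩
      · rw [hYs, Finset.coe_insert, Set.insert_subset_iff]
        exact ⟨(hf _ h1 (by omega)).1, h1⟩
      · rw [hYs]
        exact (Finset.card_insert_le _ _).trans (by omega)
  have hmono : Monotone fun k => Ideal.span ((X ∪ Y k : Finset R) : Set R) * J := by
    refine monotone_nat_of_le_succ fun k => Ideal.mul_mono_left (Ideal.span_mono ?_)
    rw [hYs]
    exact_mod_cast Finset.union_subset_union_right (Finset.subset_insert _ _)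
  -- The greedy chain yields a single `c` that gains a factor `p ^ q` over `X J`, so `insert c X`
  -- contradicts maximality.
  obtain ⟨c, hcJ, hc⟩ := Ideal.exists_card_sup_span_mul_ge hp hR J
    (fun k => Ideal.span ((X ∪ Y k : Finset R) : Set R) * J) hmono (fun k => f (Y k)) q
    (fun i hi => (hf _ (hY i hi.le).1 ((hY i hi.le).2.trans hi.le)).1)
    (fun i hi c hc => by
      rw [mul_comm c]
      refine Ideal.mul_mem_mul (Ideal.subset_span ?_) hc
      rw [hYs]; simp)
    (fun i hi => (hf _ (hY i hi.le).1 ((hY i hi.le).2.trans hi.le)).2)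
  have hY0 : X ∪ Y 0 = X := by simp [Y]
  simp only [hY0, ← Ideal.add_eq_sup, ← add_mul] at hc
  have hspan : Ideal.span (X : Set R) + Ideal.span {c} =
      Ideal.span ((insert c X : Finset R) : Set R) := by
    rw [Finset.coe_insert, Ideal.span_insert, Ideal.add_eq_sup, sup_comm]
  rw [hspan] at hc
  have hcX : c ∉ X := by
    intro hcX
    rw [Finset.insert_eq_of_mem hcX] at hc
    have h1 : 0 < Nat.card (Ideal.span (X : Set R) * J : Ideal R) := Nat.card_pos
    have h2 : 1 < p ^ q := Nat.one_lt_pow hq.ne' hp.one_lt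
    nlinarith
  have := hXmax (insert c X) ⟨by simpa [Set.insert_subset_iff] using ⟨hcJ, hXJ⟩, by
    rw [Finset.card_insert_of_notMem hcX, Nat.mul_succ, pow_add, mul_comm]
    exact (Nat.mul_le_mul_left _ hXcard).trans hc⟩
  rw [Finset.card_insert_of_notMem hcX] at this
  omega

/-! ### Generators of finite reduced rings. -/

/-- A product of at most `q ^ 2` finite fields is generated as a ring by `2 q + 1` elements. -/
theorem Pi.exists_finset_closure_eq_top {ι : Type*} [Finite ι] (K : ι → Type*)
    [∀ i, Field (K i)] [∀ i, Finite (K i)] {q : ℕ} (hι : Nat.card ι ≤ q * q) :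
    ∃ U : Finset (∀ i, K i), U.card ≤ 2 * q + 1 ∧
      Subring.closure (U : Set (∀ i, K i)) = ⊤ := by
  classical
  have := Fintype.ofFinite ι
  obtain ⟨φ⟩ : Nonempty (ι ↪ Fin q × Fin q) := by
    refine Function.Embedding.nonempty_of_card_le ?_
    rwa [Fintype.card_prod, Fintype.card_fin, ← Nat.card_eq_fintype_card]
  choose g hg using fun i => IsCyclic.exists_generator (α := (K i)ˣ)
  let u : ∀ i, K i := fun i => g i
  -- With the factors placed in a `q × q` grid, row and column indicators multiply to the idempotent
  -- of a single factor; powers of `u` then give its nonzero elements.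
  let r : Fin q → ∀ i, K i := fun a i => if (φ i).1 = a then 1 else 0
  let s : Fin q → ∀ i, K i := fun a i => if (φ i).2 = a then 1 else 0
  let U : Finset (∀ i, K i) := insert u (Finset.univ.image r ∪ Finset.univ.image s)
  refine ⟨U, ?_, ?_⟩
  · refine (Finset.card_insert_le _ _).trans (Nat.succ_le_succ ?_)
    refine (Finset.card_union_le _ _).trans ?_
    have h1 := Finset.card_image_le (s := Finset.univ) (f := r)
    have h2 := Finset.card_image_le (s := Finset.univ) (f := s)
    simp only [Finset.card_univ, Fintype.card_fin] at h1 h2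
    omega
  · rw [eq_top_iff]
    intro a _
    have hU : ∀ b ∈ U, b ∈ Subring.closure (U : Set (∀ i, K i)) := fun b hb =>
      Subring.subset_closure hb
    have hsum : a = ∑ i, Pi.single i (a i) := (Finset.univ_sum_single a).symm
    rw [hsum]
    refine Subring.sum_mem _ fun i _ => ?_
    by_cases hai : a i = 0
    · rw [hai, Pi.single_zero]; exact Subring.zero_mem _
    · obtain ⟨k, hk⟩ := (IsOfFinOrder.mem_zpowers_iff_mem_range_orderOf
        (isOfFinOrder_of_finite (g i))).1 (hg i (Units.mk0 (a i) hai)) |> Finset.mem_image.1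
      have hk : (g i : K i) ^ k = a i := by
        have := congrArg Units.val hk.2
        simpa using this
      have : Pi.single i (a i) = r (φ i).1 * s (φ i).2 * u ^ k := by
        ext j
        by_cases hj : j = i
        · subst hj; simp [r, s, u, hk]
        · rw [Pi.single_eq_of_ne hj]
          have : ¬ ((φ j).1 = (φ i).1 ∧ (φ j).2 = (φ i).2) := fun h =>
            hj (φ.injective (Prod.ext h.1 h.2))
          simp only [Pi.mul_apply, r, s]
          rcases not_and_or.1 this with h | h
          · rw [if_neg h, zero_mul, zero_mul]
          · rw [if_neg h, mul_zero, zero_mul]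
      rw [this]
      refine Subring.mul_mem _ (Subring.mul_mem _ (hU _ ?_) (hU _ ?_))
        (Subring.pow_mem _ (hU _ ?_) k) <;> simp [U]

/-- A reduced ring of order dividing `p ^ n` is generated by `O(√n)` elements. -/
theorem IsReduced.exists_finset_closure_eq_top {A : Type*} [CommRing A] [Finite A] [IsReduced A]
    {p n : ℕ} (hp : p.Prime) (hA : Nat.card A ∣ p ^ n) {q : ℕ} (hn : n ≤ q * q) :
    ∃ U : Finset A, U.card ≤ 2 * q + 1 ∧ Subring.closure (U : Set A) = ⊤ := by
  classical
  let e := (IsArtinianRing.equivPi A).toRingEquiv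
  let : ∀ I : MaximalSpectrum A, Field (A ⧸ I.asIdeal) := fun I => Ideal.Quotient.field _
  have : ∀ I : MaximalSpectrum A, Finite (A ⧸ I.asIdeal) := fun I =>
    Finite.of_surjective _ Ideal.Quotient.mk_surjective
  have := Fintype.ofFinite (MaximalSpectrum A)
  have hcard : Nat.card (MaximalSpectrum A) ≤ q * q := by
    refine le_trans ?_ hn
    rw [← Nat.pow_le_pow_iff_right hp.one_lt]
    refine le_trans ?_ (Nat.le_of_dvd (pow_pos hp.pos n) hA)
    rw [Nat.card_congr e.toEquiv, Nat.card_pi, Nat.card_eq_fintype_card, ← Finset.card_univ]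
    -- Each residue field has order at least `p`, so there are at most `n` of them.
    refine Finset.pow_card_le_prod _ _ _ fun I _ => ?_
    have h1 : Nat.card (A ⧸ I.asIdeal) ∣ p ^ n :=
      (AddSubgroup.card_quotient_dvd_card I.asIdeal.toAddSubgroup).trans hA
    obtain ⟨k, -, hk⟩ := (Nat.dvd_prime_pow hp).1 h1
    have h2 : 1 < Nat.card (A ⧸ I.asIdeal) := Finite.one_lt_card
    rw [hk] at h2 ⊢
    exact Nat.le_self_pow (by rintro rfl; simp at h2) p
  obtain ⟨U, hU, hUt⟩ := Pi.exists_finset_closure_eq_top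
    (fun I : MaximalSpectrum A => A ⧸ I.asIdeal) hcard
  refine ⟨U.image e.symm, Finset.card_image_le.trans hU, ?_⟩
  rw [Finset.coe_image, eq_top_iff]
  intro a _
  have h := (RingHom.map_closure
    (e.symm : (∀ I : MaximalSpectrum A, A ⧸ I.asIdeal) →+* A) (U : Set _)).le
  exact h ⟨e a, by rw [hUt]; trivial, e.symm_apply_apply a⟩

/-! ### Economical generating data for a ring. -/

/-- Lifting generators of `R / J` to a subring `S` with `S + J = R`. -/
theorem Subring.exists_mem_closure_sub_mem {R : Type*} [CommRing R] {J : Ideal R} {X : Set R}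
    (hX : Subring.closure (Ideal.Quotient.mk J '' X) = ⊤) (a : R) :
    ∃ s ∈ Subring.closure X, a - s ∈ J := by
  have h : Ideal.Quotient.mk J a ∈ (Subring.closure X).map (Ideal.Quotient.mk J) := by
    rw [RingHom.map_closure, hX]; trivial
  obtain ⟨s, hs, hsa⟩ := h
  exact ⟨s, hs, Ideal.Quotient.eq.1 hsa.symm⟩

/-- A nilpotent Nakayama lemma over a subring. -/
theorem Submodule.le_of_le_sup_sq {R : Type*} [CommRing R] (S : Subring R) (J : Ideal R)
    (hJ : IsNilpotent J) {X : Set R} (hXS : X ⊆ S) (hXJ : X ⊆ J)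
    (hJX : J * J ≤ Ideal.span X * J) (M : Submodule S R)
    (hM : ∀ a ∈ J, ∃ m ∈ M, a - m ∈ J * J) : ∀ a ∈ J, a ∈ M := by
  have key : ∀ k : ℕ, ∀ a ∈ J, ∃ m ∈ M, a - m ∈ J ^ k := by
    intro k
    induction k with
    | zero => exact fun a _ => ⟨0, M.zero_mem, by simp⟩
    | succ k ih =>
      -- Coefficients from `R` are absorbed into `J`, so only products `x * c` with `x ∈ X` matter;
      -- as `X ⊆ S`, multiplication by `x` preserves `M` and carries `J ^ k` into `J ^ (k + 1)`.
      have h2 : ∀ b ∈ Ideal.span X * J, ∃ m ∈ M, b - m ∈ J ^ (k + 1) := by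
        have hadd : ∀ b c : R, (∃ m ∈ M, b - m ∈ J ^ (k + 1)) →
            (∃ m ∈ M, c - m ∈ J ^ (k + 1)) → ∃ m ∈ M, b + c - m ∈ J ^ (k + 1) := by
          rintro b c ⟨m, hm, hbm⟩ ⟨m', hm', hcm⟩
          exact ⟨m + m', M.add_mem hm hm', by
            rw [add_sub_add_comm]; exact Ideal.add_mem _ hbm hcm⟩
        intro b hb
        refine Submodule.mul_induction_on hb (fun v hv c hc => ?_) hadd
        revert c
        refine Submodule.span_induction ?_ ?_ ?_ ?_ hv
        · intro x hx c hc
          obtain ⟨m, hm, hcm⟩ := ih c hc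
          refine ⟨x * m, M.smul_mem ⟨x, hXS hx⟩ hm, ?_⟩
          rw [← mul_sub, pow_succ']
          exact Ideal.mul_mem_mul (hXJ hx) hcm
        · exact fun c _ => ⟨0, M.zero_mem, by simp⟩
        · intro v w _ _ hv hw c hc
          rw [add_mul]
          exact hadd _ _ (hv c hc) (hw c hc)
        · intro r v _ hv c hc
          rw [smul_eq_mul, mul_comm r v, mul_assoc]
          exact hv _ (J.mul_mem_left r hc)
      intro a ha
      obtain ⟨m, hm, ham⟩ := hM a ha
      obtain ⟨m', hm', ham'⟩ := h2 _ (hJX ham)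
      exact ⟨m + m', M.add_mem hm hm', by rwa [← sub_sub]⟩
  obtain ⟨k, hk⟩ := hJ
  intro a ha
  obtain ⟨m, hm, ham⟩ := key k a ha
  rw [hk, Ideal.zero_eq_bot, Ideal.mem_bot, sub_eq_zero] at ham
  rwa [ham]

/-- A commutative ring of order `p ^ n` has `O(√n)` elements `X` and elements `y₁, …, y_d` such
that `1, y₁, …, y_d` generate it as a module over the subring generated by `X`, and the products
`yᵢ yⱼ` lie in a subgroup of order at most `p ^ (n - d)`. -/
theorem CommRing.exists_generating_data {R : Type*} [CommRing R] [Finite R] {p n : ℕ}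
    (hp : p.Prime) (hR : Nat.card R = p ^ n) {q : ℕ} (hq : 0 < q) (hn : n ≤ q * q) :
    ∃ (X : Finset R) (d : ℕ) (y : Fin d → R) (H : AddSubgroup R), X.card ≤ 5 * q + 1 ∧
      (∀ i j, y i * y j ∈ H) ∧ p ^ d * Nat.card H ≤ p ^ n ∧
      Submodule.span (Subring.closure (X : Set R)) (insert 1 (Set.range y)) = ⊤ := by
  classical
  let J : Ideal R := nilradical R
  obtain ⟨X, hXJ, hXq, hJX⟩ := Ideal.exists_finset_span_mul_eq hp hR J hq hn
  have hred : IsReduced (R ⧸ J) :=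
    (Ideal.isRadical_iff_quotient_reduced _).1 (Ideal.radical_isRadical _)
  have : Finite (R ⧸ J) := Finite.of_surjective _ Ideal.Quotient.mk_surjective
  obtain ⟨U, hU, hUt⟩ := IsReduced.exists_finset_closure_eq_top (A := R ⧸ J) (n := n) hp
    (hR ▸ AddSubgroup.card_quotient_dvd_card J.toAddSubgroup) hn
  let Z : Finset R := X ∪ U.image (Function.surjInv Ideal.Quotient.mk_surjective)
  let S := Subring.closure (Z : Set R)
  have hXS : (X : Set R) ⊆ S := fun x hx => Subring.subset_closure (by simp_all [Z])
  have hSJ : ∀ a : R, ∃ s ∈ S, a - s ∈ J := by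
    refine Subring.exists_mem_closure_sub_mem (top_le_iff.1 (hUt ▸ Subring.closure_mono ?_))
    intro u hu
    exact ⟨Function.surjInv Ideal.Quotient.mk_surjective u,
      by simpa [Z] using Or.inr ⟨u, hu, rfl⟩, Function.surjInv_eq _ u⟩
  -- The `y i` generate `J` modulo `J * J` over `S`; the nilpotent Nakayama lemma below removes the
  -- `J * J`.
  obtain ⟨d, y, hy, hd⟩ := Submodule.exists_fin_generators (A := S) hp hR
    (J.restrictScalars S) ((J * J).restrictScalars S) Ideal.mul_le_left
  have hyJ : ∀ i, y i ∈ J := fun i => by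
    have : y i ∈ J.restrictScalars S :=
      hy ▸ Submodule.mem_sup_right (Submodule.subset_span ⟨i, rfl⟩)
    exact this
  refine ⟨Z, d, y, (J * J).toAddSubgroup, ?_, fun i j => Ideal.mul_mem_mul (hyJ i) (hyJ j),
    ?_, ?_⟩
  · have h1 := Finset.card_union_le X (U.image (Function.surjInv Ideal.Quotient.mk_surjective))
    have h2 := Finset.card_image_le (s := U)
      (f := Function.surjInv (Ideal.Quotient.mk_surjective (I := J)))
    change Z.card ≤ _ at h1
    omega
  · refine le_trans hd ?_
    exact hR ▸ Finite.card_subtype_le _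
  · have hJM : ∀ a ∈ J, a ∈ Submodule.span S (Set.range y) := by
      refine Submodule.le_of_le_sup_sq S J (IsNoetherianRing.isNilpotent_nilradical R) hXS hXJ
        hJX _ fun a ha => ?_
      have : a ∈ J.restrictScalars S := ha
      rw [← hy] at this
      obtain ⟨b, hb, m, hm, rfl⟩ := Submodule.mem_sup.1 this
      exact ⟨m, hm, by rw [add_sub_cancel_right]; exact hb⟩
    rw [eq_top_iff]
    intro a _
    obtain ⟨s, hs, has⟩ := hSJ a
    have h1 : s ∈ Submodule.span S (insert 1 (Set.range y)) := by
      have := Submodule.smul_mem _ (⟨s, hs⟩ : S)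
        (Submodule.subset_span (s := insert 1 (Set.range y)) (R := S) (Set.mem_insert _ _))
      simpa [Subring.smul_def] using this
    have h2 := Submodule.span_mono (R := S) (Set.subset_insert 1 (Set.range y)) (hJM _ has)
    simpa using Submodule.add_mem _ h2 h1

/-! ### Encoding a ring on its additive group. -/

/-- An additive bijection between commutative rings is multiplicative as soon as it matches
the unit, the multiplications by the `x i` and the products `y i * y j`, where `1` and the `y i`
generate the source as a module over the subring generated by the `x i`. -/
theorem AddEquiv.map_mul_of_generators {R R' : Type*} [CommRing R] [CommRing R'] (ψ : R ≃+ R')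
    {s d : ℕ} (x : Fin s → R) (x' : Fin s → R') (y : Fin d → R) (y' : Fin d → R')
    (h1 : ψ 1 = 1) (hx : ∀ i r, ψ (x i * r) = x' i * ψ r) (hy : ∀ i, ψ (y i) = y' i)
    (hyy : ∀ i j, ψ (y i * y j) = y' i * y' j)
    (hspan : Submodule.span (Subring.closure (Set.range x)) (insert 1 (Set.range y)) = ⊤)
    (a b : R) : ψ (a * b) = ψ a * ψ b := by
  -- The `c` for which `ψ` respects multiplication by `c` form a subring. Given this, it remains to
  -- check products of module generators.
  have hS : ∀ c ∈ Subring.closure (Set.range x), ∀ r, ψ (c * r) = ψ c * ψ r := by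
    intro c hc
    induction hc using Subring.closure_induction with
    | mem c hc =>
      obtain ⟨i, rfl⟩ := hc
      intro r
      have := hx i 1
      rw [mul_one, h1, mul_one] at this
      rw [hx, this]
    | zero => simp
    | one => simp [h1]
    | add u v _ _ hu hv => intro r; simp only [add_mul, map_add, hu, hv]
    | neg u _ hu => intro r; simp only [neg_mul, map_neg, hu]
    | mul u v _ _ hu hv => intro r; rw [mul_assoc, hu, hv, hu, mul_assoc]
  have hspan' : ∀ f : R → Prop, f 1 → (∀ i, f (y i)) → (∀ u v, f u → f v → f (u + v)) → f 0 →
      (∀ c ∈ Subring.closure (Set.range x), ∀ u, f u → f (c * u)) → ∀ u, f u := by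
    intro f h1 hy hadd h0 hmul u
    have hu : u ∈ Submodule.span (Subring.closure (Set.range x)) (insert 1 (Set.range y)) :=
      hspan ▸ trivial
    induction hu using Submodule.span_induction with
    | mem u hu =>
      rcases hu with rfl | ⟨i, rfl⟩
      · exact h1
      · exact hy i
    | zero => exact h0
    | add u v _ _ hu hv => exact hadd u v hu hv
    | smul c u _ hu => exact hmul c c.2 u hu
  have hyr : ∀ i r, ψ (y i * r) = ψ (y i) * ψ r := by
    intro i
    refine hspan' _ (by simp [h1]) (fun j => by rw [hyy, hy, hy]) ?_ (by simp) ?_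
    · intro u v hu hv
      simp only [mul_add, map_add, hu, hv]
    · intro c hc u hu
      rw [mul_left_comm, hS c hc, hS c hc, hu, mul_left_comm]
  revert a
  refine hspan' _ (by simp [h1]) (fun i => hyr i b) ?_ (by simp) ?_
  · intro u v hu hv
    simp only [add_mul, map_add, hu, hv]
  · intro c hc u hu
    rw [mul_assoc, hS c hc, hS c hc, hu, mul_assoc]

/-- Data on an additive group that suffice to reconstruct a commutative ring structure. -/
abbrev RingCode (p n s : ℕ) (G : Type) [AddCommGroup G] : Type :=
  G × (Fin s → AddMonoid.End G) × Σ d : Fin (n + 1), (Fin d → G) ×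
    Σ H : {H : AddSubgroup G // p ^ (d : ℕ) * Nat.card H ≤ p ^ n}, (Sym2 (Fin d) → H.1)

/-- The code `c` describes the ring `R`. -/
def RingCode.Describes {p n s : ℕ} {G : Type} [AddCommGroup G] (c : RingCode p n s G)
    (R : Type) [CommRing R] : Prop :=
  ∃ (φ : R ≃+ G) (x : Fin s → R) (y : Fin c.2.2.1 → R), φ 1 = c.1 ∧
    (∀ i r, φ (x i * r) = c.2.1 i (φ r)) ∧ (∀ i, φ (y i) = c.2.2.2.1 i) ∧
    (∀ i j, φ (y i * y j) = c.2.2.2.2.2 s(i, j)) ∧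
    Submodule.span (Subring.closure (Set.range x)) (insert 1 (Set.range y)) = ⊤

theorem RingCode.Describes.nonempty_ringEquiv {p n s : ℕ} {G : Type} [AddCommGroup G]
    {c : RingCode p n s G} {R R' : Type} [CommRing R] [CommRing R'] (h : c.Describes R)
    (h' : c.Describes R') : Nonempty (R ≃+* R') := by
  obtain ⟨φ, x, y, h1, hx, hy, hyy, hspan⟩ := h
  obtain ⟨φ', x', y', h1', hx', hy', hyy', -⟩ := h'
  have hψ : ∀ r r', φ r = φ' r' → (φ.trans φ'.symm) r = r' := fun r r' h => by
    simp [h]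
  refine ⟨{ φ.trans φ'.symm with
    map_mul' := AddEquiv.map_mul_of_generators (φ.trans φ'.symm) x x' y y' ?_ ?_ ?_ ?_ hspan }⟩
  · exact hψ _ _ (h1.trans h1'.symm)
  · intro i r
    refine hψ _ _ ?_
    rw [hx, hx']; simp
  · exact fun i => hψ _ _ ((hy i).trans (hy' i).symm)
  · exact fun i j => hψ _ _ ((hyy i j).trans (hyy' i j).symm)

/-- Padding by `0` gives generating families of a fixed length, so that they can be counted as
functions on `Fin s`. -/
theorem Finset.exists_fin_range {M : Type*} [Zero M] (X : Finset M) {s : ℕ} (h : X.card ≤ s) :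
    ∃ x : Fin s → M, (X : Set M) ⊆ Set.range x ∧ Set.range x ⊆ insert 0 (X : Set M) := by
  refine ⟨fun i => if hi : (i : ℕ) < X.card then (X.equivFin.symm ⟨i, hi⟩ : M) else 0, ?_, ?_⟩
  · intro a ha
    refine ⟨⟨X.equivFin ⟨a, ha⟩, (X.equivFin ⟨a, ha⟩).2.trans_le h⟩, ?_⟩
    simp
  · rintro _ ⟨i, rfl⟩
    dsimp only
    split_ifs with hi
    · exact Or.inr (X.equivFin.symm ⟨i, hi⟩).2
    · exact Or.inl rfl

theorem RingCode.exists_describes {p n q : ℕ} (hp : p.Prime) (hq : 0 < q) (hn : n ≤ q * q)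
    {R : Type} [CommRing R] (hR : Nat.card R = p ^ n) {G : Type} [AddCommGroup G] (φ : R ≃+ G) :
    ∃ c : RingCode p n (5 * q + 1) G, c.Describes R := by
  classical
  have : Finite R := Nat.finite_of_card_ne_zero (hR ▸ (pow_pos hp.pos n).ne')
  obtain ⟨X, d, y, H, hX, hyH, hd, hspan⟩ := CommRing.exists_generating_data hp hR hq hn
  obtain ⟨x, hXx, -⟩ := X.exists_fin_range hX
  have hdn : d < n + 1 := by
    have h1 : 0 < Nat.card H := Nat.card_pos
    have h2 : p ^ d ≤ p ^ n := le_trans (Nat.le_mul_of_pos_right _ h1) hd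
    have := (Nat.pow_le_pow_iff_right hp.one_lt).1 h2
    omega
  let H' : AddSubgroup G := H.map (φ : R →+ G)
  have hH' : p ^ d * Nat.card H' ≤ p ^ n := by
    rwa [Nat.card_congr (H.equivMapOfInjective (φ : R →+ G) φ.injective).toEquiv.symm]
  let z : Sym2 (Fin d) → H' := Sym2.lift ⟨fun i j => ⟨φ (y i * y j), y i * y j, hyH i j, rfl⟩,
    fun i j => by simp only [mul_comm]⟩
  refine ⟨⟨φ 1, fun i => (φ : R →+ G).comp ((AddMonoidHom.mulLeft (x i)).comp
    (φ.symm : G →+ R)), ⟨d, hdn⟩, fun i => φ (y i), ⟨H', hH'⟩, z⟩, φ, x, y, rfl, ?_,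
    fun i => rfl, fun i j => rfl, ?_⟩
  · intro i r
    change _ = φ (x i * φ.symm (φ r))
    simp
  · rw [eq_top_iff]
    intro a _
    have ha : a ∈ Submodule.span (Subring.closure (X : Set R)) (insert 1 (Set.range y)) :=
      hspan ▸ trivial
    induction ha using Submodule.span_induction with
    | mem u hu => exact Submodule.subset_span hu
    | zero => exact Submodule.zero_mem _
    | add u v _ _ hu hv => exact Submodule.add_mem _ (hu trivial) (hv trivial)
    | smul c u _ hu =>
      exact Submodule.smul_mem _ (⟨c, Subring.closure_mono hXx c.2⟩ :
        Subring.closure (Set.range x)) (hu trivial)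

/-! ### Counting the codes. -/

theorem Nat.card_sigma_le_mul {α : Type*} [Finite α] {β : α → Type*} [∀ a, Finite (β a)] {b : ℕ}
    (h : ∀ a, Nat.card (β a) ≤ b) : Nat.card (Σ a, β a) ≤ Nat.card α * b := by
  have := Fintype.ofFinite α
  rw [Nat.card_sigma, Nat.card_eq_fintype_card, ← smul_eq_mul, ← Finset.card_univ]
  exact Finset.sum_le_card_nsmul _ _ _ fun a _ => h a

theorem AddSubgroup.exists_fin_closure_eq {G : Type*} [AddCommGroup G] [Finite G] {p n : ℕ}
    (hp : p.Prime) (hG : Nat.card G = p ^ n) (H : AddSubgroup G) :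
    ∃ y : Fin n → G, AddSubgroup.closure (Set.range y) = H := by
  classical
  obtain ⟨d, y, hy, hd⟩ := Submodule.exists_fin_generators hp hG H.toIntSubmodule ⊥ bot_le
  have hdn : d ≤ n := by
    rw [← Nat.pow_le_pow_iff_right hp.one_lt, ← hG]
    refine le_trans ?_ (Finite.card_subtype_le (· ∈ H.toIntSubmodule))
    refine le_trans ?_ hd
    exact Nat.le_mul_of_pos_right _ Nat.card_pos
  obtain ⟨z, hz1, hz2⟩ := (Finset.univ.image y).exists_fin_range (s := n)
    (Finset.card_image_le.trans (by simpa using hdn))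
  simp only [Finset.coe_image, Finset.coe_univ, Set.image_univ] at hz1 hz2
  have hcl : AddSubgroup.closure (Set.range y) = H := by
    rw [← Submodule.span_int_eq_addSubgroupClosure, ← bot_sup_eq (Submodule.span ℤ _), hy]
    rfl
  refine ⟨z, le_antisymm ?_ ?_⟩
  · rw [AddSubgroup.closure_le]
    refine hz2.trans (Set.insert_subset H.zero_mem ?_)
    rw [← hcl]; exact AddSubgroup.subset_closure
  · exact hcl.symm.le.trans (AddSubgroup.closure_mono hz1)

theorem AddSubgroup.card_addSubgroups_le {G : Type*} [AddCommGroup G] [Finite G] {p n : ℕ}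
    (hp : p.Prime) (hG : Nat.card G = p ^ n) : Nat.card (AddSubgroup G) ≤ p ^ (n * n) := by
  have := Nat.card_le_card_of_surjective
    (fun y : Fin n → G => AddSubgroup.closure (Set.range y))
    (AddSubgroup.exists_fin_closure_eq hp hG)
  rwa [Nat.card_fun, hG, ← pow_mul, Nat.card_eq_fintype_card (α := Fin n),
    Fintype.card_fin] at this

instance AddMonoid.End.finite_of_finite (G : Type*) [AddCommGroup G] [Finite G] :
    Finite (AddMonoid.End G) :=
  Finite.of_injective (fun f : AddMonoid.End G => (f : G → G)) DFunLike.coe_injective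

theorem AddMonoid.End.card_le {G : Type*} [AddCommGroup G] [Finite G] {p n : ℕ}
    (hp : p.Prime) (hG : Nat.card G = p ^ n) : Nat.card (AddMonoid.End G) ≤ p ^ (n * n) := by
  obtain ⟨y, hy⟩ := AddSubgroup.exists_fin_closure_eq hp hG ⊤
  have := Nat.card_le_card_of_injective (fun (f : AddMonoid.End G) (i : Fin n) => f (y i)) ?_
  · rwa [Nat.card_fun, hG, ← pow_mul, Nat.card_eq_fintype_card (α := Fin n),
      Fintype.card_fin] at this
  · intro f g hfg
    refine AddMonoidHom.eq_of_eqOn_dense hy ?_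
    rintro _ ⟨i, rfl⟩
    exact congrFun hfg i

theorem RingCode.card_le {p n s E : ℕ} {G : Type} [AddCommGroup G] [Finite G]
    (hp : p.Prime) (hG : Nat.card G = p ^ n)
    (hE : ∀ d ≤ n, (n - d) * (d + 1).choose 2 ≤ E) :
    Nat.card (RingCode p n s G) ≤
      p ^ n * (p ^ (n * n * s) * ((n + 1) * (p ^ (n * n) * (p ^ (n * n) * p ^ E)))) := by
  rw [Nat.card_prod, Nat.card_prod, hG]
  refine Nat.mul_le_mul_left _ (Nat.mul_le_mul ?_ ?_)
  · rw [Nat.card_fun, Nat.card_eq_fintype_card (α := Fin s), Fintype.card_fin, pow_mul]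
    exact Nat.pow_le_pow_left (AddMonoid.End.card_le hp hG) _
  · refine (Nat.card_sigma_le_mul (b := p ^ (n * n) * (p ^ (n * n) * p ^ E)) fun d => ?_).trans
      (by simp)
    have hdn : (d : ℕ) ≤ n := Nat.lt_succ_iff.1 d.2
    rw [Nat.card_prod]
    refine Nat.mul_le_mul ?_ ?_
    · rw [Nat.card_fun, hG, ← pow_mul, Nat.card_eq_fintype_card, Fintype.card_fin]
      exact Nat.pow_le_pow_right hp.pos (Nat.mul_le_mul_left _ hdn)
    · refine (Nat.card_sigma_le_mul (b := p ^ E) fun H => ?_).trans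
        (Nat.mul_le_mul_right _ ((Finite.card_subtype_le _).trans
          (AddSubgroup.card_addSubgroups_le hp hG)))
      -- The main term: `(d + 1).choose 2` unordered products, each in a group of order at most `p ^
      -- (n - d)`.
      have hH : Nat.card H.1 ≤ p ^ (n - d) := by
        refine Nat.le_of_mul_le_mul_left (H.2.trans_eq ?_) (pow_pos hp.pos d)
        rw [← pow_add, Nat.add_sub_cancel' hdn]
      rw [Nat.card_fun, Nat.card_eq_fintype_card (α := Sym2 _), Sym2.card, Fintype.card_fin]
      refine (Nat.pow_le_pow_left hH _).trans ?_
      rw [← pow_mul]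
      exact Nat.pow_le_pow_right hp.pos (hE d hdn)

/-! ### Abelian groups of order `p ^ n` and the upper bound. -/

/-- Parameters for the abelian groups of order `p ^ n`. -/
abbrev AbelianType (n : ℕ) : Type := Σ m : Fin (n + 1), Fin m → Fin (n + 1)

abbrev AbelianType.Group (p : ℕ) {n : ℕ} (t : AbelianType n) : Type :=
  ∀ i, ZMod (p ^ (t.2 i : ℕ))

theorem AbelianType.card_le {p : ℕ} (hp : p.Prime) (n : ℕ) :
    Nat.card (AbelianType n) ≤ p ^ (n + n * n) := by
  have hn : n + 1 ≤ p ^ n := n.lt_two_pow_self.trans_le (Nat.pow_le_pow_left hp.two_le n)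
  refine (Nat.card_sigma_le_mul (b := p ^ (n * n)) fun m => ?_).trans ?_
  · rw [Nat.card_fun, Nat.card_eq_fintype_card, Nat.card_eq_fintype_card, Fintype.card_fin,
      Fintype.card_fin]
    calc (n + 1) ^ (m : ℕ) ≤ (n + 1) ^ n := Nat.pow_le_pow_right n.succ_pos (by omega)
      _ ≤ (p ^ n) ^ n := Nat.pow_le_pow_left hn n
      _ = p ^ (n * n) := (pow_mul _ _ _).symm
  · rw [pow_add]
    simpa using Nat.mul_le_mul_right _ hn

theorem AbelianType.exists_addEquiv {p n : ℕ} (hp : p.Prime) {G : Type} [AddCommGroup G]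
    (hG : Nat.card G = p ^ n) : ∃ t : AbelianType n, Nonempty (G ≃+ t.Group p) := by
  classical
  have : Finite G := Nat.finite_of_card_ne_zero (hG ▸ (pow_pos hp.pos n).ne')
  obtain ⟨ι, _, N, hN, ⟨e⟩⟩ := AddCommGroup.equiv_directSum_zmod_of_finite' G
  let e' : G ≃+ ∀ i, ZMod (N i) := e.trans (DirectSum.addEquivProd _)
  have hprod : ∏ i, N i = p ^ n := by
    rw [← hG, Nat.card_congr e'.toEquiv, Nat.card_pi]
    simp
  have hdvd : ∀ i, ∃ a ≤ n, N i = p ^ a := fun i =>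
    (Nat.dvd_prime_pow hp).1 (hprod ▸ Finset.dvd_prod_of_mem N (Finset.mem_univ i))
  choose a han hNa using hdvd
  obtain rfl : N = fun i => p ^ a i := funext hNa
  have hι : Fintype.card ι ≤ n := by
    rw [← Nat.pow_le_pow_iff_right hp.one_lt, ← hprod, ← Finset.card_univ]
    refine Finset.pow_card_le_prod _ _ _ fun i _ => ?_
    refine Nat.le_self_pow (fun h0 => ?_) p
    have := hN i
    simp [h0] at this
  let σ := Fintype.equivFin ι
  refine ⟨⟨⟨Fintype.card ι, Nat.lt_succ_of_le hι⟩,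
    fun j => ⟨a (σ.symm j), Nat.lt_succ_of_le (han _)⟩⟩, ⟨e'.trans ?_⟩⟩
  exact (RingEquiv.piCongrLeft (fun i => ZMod (p ^ a i)) σ.symm).symm.toAddEquiv

/-- The set of isomorphism classes of commutative rings of order `p ^ n` is finite, with at most
`p ^ (E + O(n ^ 2 q))` elements, where `q ≥ √n` and `E` is the maximum of
`(n - d) d (d + 1) / 2`. -/
theorem finite_and_numCommRings_le {p n q E : ℕ} (hp : p.Prime) (hq : 0 < q) (hn : n ≤ q * q)
    (hE : ∀ d ≤ n, (n - d) * (d + 1).choose 2 ≤ E) :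
    Finite (Quotient (commRingIsoSetoid (p ^ n))) ∧
      numCommRings (p ^ n) ≤ p ^ (n + n * n) *
        (p ^ n * (p ^ (n * n * (5 * q + 1)) *
          ((n + 1) * (p ^ (n * n) * (p ^ (n * n) * p ^ E))))) := by
  -- The parameters also describe groups of other orders; these are discarded.
  let T := {t : AbelianType n // Nat.card (t.Group p) = p ^ n}
  have hfin : ∀ t : T, Finite (t.1.Group p) := fun t =>
    Nat.finite_of_card_ne_zero (by rw [t.2]; exact (pow_pos hp.pos n).ne')
  have hex : ∀ Q : Quotient (commRingIsoSetoid (p ^ n)),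
      ∃ c : Σ t : T, RingCode p n (5 * q + 1) (t.1.Group p), c.2.Describes Q.out.1 := by
    intro Q
    obtain ⟨t, ⟨φ⟩⟩ := AbelianType.exists_addEquiv hp Q.out.2
    obtain ⟨c, hc⟩ := RingCode.exists_describes hp hq hn Q.out.2 φ
    exact ⟨⟨⟨t, (Nat.card_congr φ.toEquiv).symm.trans Q.out.2⟩, c⟩, hc⟩
  choose c hc using hex
  have hinj : Function.Injective c := by
    intro Q Q' h
    rw [← Q.out_eq, ← Q'.out_eq]
    refine Quotient.sound ?_
    have h' := hc Q'
    rw [← h] at h'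
    exact (hc Q).nonempty_ringEquiv h'
  refine ⟨Finite.of_injective c hinj, (Nat.card_le_card_of_injective c hinj).trans ?_⟩
  refine (Nat.card_sigma_le_mul fun t => RingCode.card_le hp t.2 hE).trans ?_
  exact Nat.mul_le_mul_right _ ((Finite.card_subtype_le _).trans (AbelianType.card_le hp n))

/-! ### Rings from symmetric bilinear maps and the lower bound. -/

/-- For a symmetric bilinear map `β : V × V → W` given in coordinates, the ring
`F ⊕ V ⊕ W` in which `W` annihilates `V ⊕ W` and `V` is multiplied by `β`. -/
structure QuadraticExtension {F : Type} {d r : ℕ} (β : Sym2 (Fin d) → Fin r → F) : Type where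
  scalar : F
  lin : Fin d → F
  quad : Fin r → F

namespace QuadraticExtension

variable {F : Type} {d r : ℕ} {β : Sym2 (Fin d) → Fin r → F}

theorem ext_iff' {x y : QuadraticExtension β} :
    x = y ↔ x.scalar = y.scalar ∧ x.lin = y.lin ∧ x.quad = y.quad := by
  cases x; cases y; simp

/-- The underlying triple. -/
def toProd (x : QuadraticExtension β) : F × (Fin d → F) × (Fin r → F) :=
  (x.scalar, x.lin, x.quad)

theorem toProd_bijective : Function.Bijective (toProd (β := β)) :=
  ⟨fun x y h => by cases x; cases y; simpa [toProd] using h, fun t => ⟨⟨t.1, t.2.1, t.2.2⟩, rfl⟩⟩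

variable [CommRing F]

/-- The product `V × V → W`. -/
def form (β : Sym2 (Fin d) → Fin r → F) (v w : Fin d → F) : Fin r → F :=
  fun k => ∑ i, ∑ j, v i * w j * β s(i, j) k

theorem form_comm (v w : Fin d → F) : form β v w = form β w v := by
  ext k
  simp only [form]
  rw [Finset.sum_comm]
  refine Finset.sum_congr rfl fun i _ => Finset.sum_congr rfl fun j _ => ?_
  rw [Sym2.eq_swap, mul_comm (v j)]

theorem form_add (v w w' : Fin d → F) : form β v (w + w') = form β v w + form β v w' := by
  ext k
  simp only [form, Pi.add_apply, ← Finset.sum_add_distrib, mul_add, add_mul]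

theorem form_smul (a : F) (v w : Fin d → F) : form β v (a • w) = a • form β v w := by
  ext k
  simp only [form, Pi.smul_apply, smul_eq_mul, Finset.mul_sum]
  refine Finset.sum_congr rfl fun i _ => Finset.sum_congr rfl fun j _ => ?_
  ring

theorem add_form (v v' w : Fin d → F) : form β (v + v') w = form β v w + form β v' w := by
  rw [form_comm, form_add, form_comm w v, form_comm w v']

theorem smul_form (a : F) (v w : Fin d → F) : form β (a • v) w = a • form β v w := by
  rw [form_comm, form_smul, form_comm]

theorem form_zero (v : Fin d → F) : form β v 0 = 0 := by
  simpa using form_smul (β := β) 0 v 0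

theorem zero_form (v : Fin d → F) : form β 0 v = 0 := by rw [form_comm, form_zero]

theorem form_single (i j : Fin d) :
    form β (Pi.single i 1) (Pi.single j 1) = β s(i, j) := by
  ext k
  simp [form, Pi.single_apply]

instance : Zero (QuadraticExtension β) := ⟨⟨0, 0, 0⟩⟩
instance : One (QuadraticExtension β) := ⟨⟨1, 0, 0⟩⟩
instance : Add (QuadraticExtension β) :=
  ⟨fun x y => ⟨x.scalar + y.scalar, x.lin + y.lin, x.quad + y.quad⟩⟩
instance : Neg (QuadraticExtension β) := ⟨fun x => ⟨-x.scalar, -x.lin, -x.quad⟩⟩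
instance : Mul (QuadraticExtension β) :=
  ⟨fun x y => ⟨x.scalar * y.scalar, x.scalar • y.lin + y.scalar • x.lin,
    x.scalar • y.quad + y.scalar • x.quad + form β x.lin y.lin⟩⟩

@[simp] theorem zero_scalar : (0 : QuadraticExtension β).scalar = 0 := rfl
@[simp] theorem zero_lin : (0 : QuadraticExtension β).lin = 0 := rfl
@[simp] theorem zero_quad : (0 : QuadraticExtension β).quad = 0 := rfl
@[simp] theorem one_scalar : (1 : QuadraticExtension β).scalar = 1 := rfl
@[simp] theorem one_lin : (1 : QuadraticExtension β).lin = 0 := rfl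
@[simp] theorem one_quad : (1 : QuadraticExtension β).quad = 0 := rfl
@[simp] theorem add_scalar (x y : QuadraticExtension β) :
    (x + y).scalar = x.scalar + y.scalar := rfl
@[simp] theorem add_lin (x y : QuadraticExtension β) : (x + y).lin = x.lin + y.lin := rfl
@[simp] theorem add_quad (x y : QuadraticExtension β) : (x + y).quad = x.quad + y.quad := rfl
@[simp] theorem neg_scalar (x : QuadraticExtension β) : (-x).scalar = -x.scalar := rfl
@[simp] theorem neg_lin (x : QuadraticExtension β) : (-x).lin = -x.lin := rfl
@[simp] theorem neg_quad (x : QuadraticExtension β) : (-x).quad = -x.quad := rfl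
@[simp] theorem mul_scalar (x y : QuadraticExtension β) :
    (x * y).scalar = x.scalar * y.scalar := rfl
@[simp] theorem mul_lin (x y : QuadraticExtension β) :
    (x * y).lin = x.scalar • y.lin + y.scalar • x.lin := rfl
@[simp] theorem mul_quad (x y : QuadraticExtension β) : (x * y).quad =
    x.scalar • y.quad + y.scalar • x.quad + form β x.lin y.lin := rfl

instance : CommRing (QuadraticExtension β) where
  add_assoc x y z := by simp [ext_iff', add_assoc]
  zero_add x := by simp [ext_iff']
  add_zero x := by simp [ext_iff']
  add_comm x y := by simp [ext_iff', add_comm]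
  neg_add_cancel x := by simp [ext_iff']
  nsmul := nsmulRec
  zsmul := zsmulRec
  zero_mul x := by simp [ext_iff', zero_form]
  mul_zero x := by simp [ext_iff', form_zero]
  one_mul x := by simp [ext_iff', zero_form]
  mul_one x := by simp [ext_iff', form_zero]
  mul_comm x y := by
    refine ext_iff'.2 ⟨mul_comm _ _, add_comm _ _, ?_⟩
    simp only [mul_quad, form_comm y.lin]
    abel
  left_distrib x y z := by
    refine ext_iff'.2 ⟨mul_add _ _ _, ?_, ?_⟩
    · simp only [mul_lin, add_lin, add_scalar]
      module
    · simp only [mul_quad, add_lin, add_quad, add_scalar, form_add]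
      module
  right_distrib x y z := by
    refine ext_iff'.2 ⟨add_mul _ _ _, ?_, ?_⟩
    · simp only [mul_lin, add_lin, add_scalar]
      module
    · simp only [mul_quad, add_lin, add_quad, add_scalar, add_form]
      module
  mul_assoc x y z := by
    refine ext_iff'.2 ⟨mul_assoc _ _ _, ?_, ?_⟩
    · simp only [mul_lin, mul_scalar]
      module
    · simp only [mul_quad, mul_lin, mul_scalar, form_add, add_form, form_smul, smul_form]
      module

theorem card_eq (p d r : ℕ) (β : Sym2 (Fin d) → Fin r → ZMod p) :
    Nat.card (QuadraticExtension β) = p ^ (d + r + 1) := by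
  rw [Nat.card_congr (Equiv.ofBijective _ toProd_bijective), Nat.card_prod, Nat.card_prod,
    Nat.card_fun, Nat.card_fun]
  simp only [Nat.card_zmod, Nat.card_eq_fintype_card (α := Fin _), Fintype.card_fin]
  ring

/-- The basis vector of `V` indexed by `i`. -/
def linBasis (β : Sym2 (Fin d) → Fin r → F) (i : Fin d) : QuadraticExtension β :=
  ⟨0, Pi.single i 1, 0⟩

/-- The basis vector of `W` indexed by `k`. -/
def quadBasis (β : Sym2 (Fin d) → Fin r → F) (k : Fin r) : QuadraticExtension β :=
  ⟨0, 0, Pi.single k 1⟩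

end QuadraticExtension

namespace QuadraticExtension

variable {p d r : ℕ}

/-- The projection to the scalar part, as an additive map. -/
def scalarHom (β : Sym2 (Fin d) → Fin r → ZMod p) : QuadraticExtension β →+ ZMod p where
  toFun := scalar
  map_zero' := rfl
  map_add' _ _ := rfl

/-- The projection to the linear part, as an additive map. -/
def linHom (β : Sym2 (Fin d) → Fin r → ZMod p) : QuadraticExtension β →+ (Fin d → ZMod p) where
  toFun := lin
  map_zero' := rfl
  map_add' _ _ := rfl

/-- The projection to the quadratic part, as an additive map. -/
def quadHom (β : Sym2 (Fin d) → Fin r → ZMod p) : QuadraticExtension β →+ (Fin r → ZMod p) where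
  toFun := quad
  map_zero' := rfl
  map_add' _ _ := rfl

theorem sum_nsmul_quadBasis (β : Sym2 (Fin d) → Fin r → ZMod p) (m : Fin r → ℕ) :
    ∑ k, m k • quadBasis β k = ⟨0, 0, fun k => (m k : ZMod p)⟩ := by
  refine ext_iff'.2 ⟨?_, ?_, ?_⟩
  · change scalarHom β _ = 0
    simp [scalarHom, quadBasis]
  · change linHom β _ = 0
    simp [linHom, quadBasis]
  · change quadHom β _ = _
    rw [map_sum]
    ext j
    simp only [map_nsmul]
    simp [quadHom, quadBasis, Pi.single_apply]

theorem linBasis_mul [NeZero p] (β : Sym2 (Fin d) → Fin r → ZMod p) (i j : Fin d) :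
    linBasis β i * linBasis β j = ∑ k, (β s(i, j) k).val • quadBasis β k := by
  rw [sum_nsmul_quadBasis]
  refine ext_iff'.2 ⟨?_, ?_, ?_⟩
  · simp [linBasis]
  · simp [linBasis]
  · simp [linBasis, form_single]

/-- The entries of `β` are the coordinates of the products of linear basis vectors. They are written
as natural multiples so that any ring isomorphism transports them. -/
theorem eq_of_ringEquiv [NeZero p] {β β' : Sym2 (Fin d) → Fin r → ZMod p} {R : Type*} [CommRing R]
    (φ : QuadraticExtension β ≃+* R) (φ' : QuadraticExtension β' ≃+* R)
    (hlin : ∀ i, φ (linBasis β i) = φ' (linBasis β' i))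
    (hquad : ∀ k, φ (quadBasis β k) = φ' (quadBasis β' k)) : β = β' := by
  funext z
  induction z using Sym2.ind with
  | _ i j =>
    have h : φ (linBasis β i * linBasis β j) = φ' (linBasis β' i * linBasis β' j) := by
      rw [map_mul, map_mul, hlin, hlin]
    rw [linBasis_mul, linBasis_mul, map_sum φ'] at h
    simp only [map_nsmul φ', ← hquad] at h
    simp only [← map_nsmul φ, ← map_sum φ] at h
    have h := φ.injective h
    rw [sum_nsmul_quadBasis, sum_nsmul_quadBasis] at h
    simpa using congrArg quad h

end QuadraticExtension

open QuadraticExtension in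
theorem pow_le_numCommRings_mul {p d r : ℕ} (hp : p.Prime)
    (hfin : Finite (Quotient (commRingIsoSetoid (p ^ (d + r + 1))))) :
    p ^ (r * (d + 1).choose 2) ≤
      numCommRings (p ^ (d + r + 1)) * p ^ ((d + r + 1) * (d + r)) := by
  have : NeZero p := ⟨hp.ne_zero⟩
  let B := Sym2 (Fin d) → Fin r → ZMod p
  let cls : B → Quotient (commRingIsoSetoid (p ^ (d + r + 1))) := fun β =>
    Quotient.mk _ ⟨CommRingCat.of (QuadraticExtension β), card_eq p d r β⟩
  have hiso : ∀ β, Nonempty (QuadraticExtension β ≃+* (cls β).out.1) := fun β =>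
    Quotient.exact (s := commRingIsoSetoid (p ^ (d + r + 1))) (Quotient.out_eq (cls β)).symm
  let φ := fun β => (hiso β).some
  have hbij : ∀ Q : Quotient (commRingIsoSetoid (p ^ (d + r + 1))),
      Nonempty (Q.out.1 ≃ Fin (p ^ (d + r + 1))) := fun Q => by
    have : Finite Q.out.1 :=
      Nat.finite_of_card_ne_zero (by rw [Q.out.2]; exact (pow_pos hp.pos _).ne')
    exact ⟨Finite.equivFinOfCardEq Q.out.2⟩
  let e := fun Q => (hbij Q).some
  -- A form is recorded by its class and the positions of the `d + r` basis vectors in the chosen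
  -- representative of that class.
  let code : B → Quotient (commRingIsoSetoid (p ^ (d + r + 1))) ×
      (Fin d ⊕ Fin r → Fin (p ^ (d + r + 1))) := fun β =>
    (cls β, fun z => e (cls β) (φ β (z.elim (linBasis β) (quadBasis β))))
  have hinj : Function.Injective code := by
    intro β β' h
    simp only [code, Prod.mk.injEq] at h
    obtain ⟨h1, h2⟩ := h
    -- The class is generalised to `Q` so that the equality of classes can be substituted in the
    -- dependent types.
    have key : ∀ (Q : Quotient (commRingIsoSetoid (p ^ (d + r + 1))))
        (ψ : QuadraticExtension β' ≃+* Q.out.1), cls β = Q →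
        (fun z => e (cls β) (φ β (Sum.elim (linBasis β) (quadBasis β) z))) =
          (fun z => e Q (ψ (Sum.elim (linBasis β') (quadBasis β') z))) → β = β' := by
      rintro Q ψ rfl h
      exact eq_of_ringEquiv (φ β) ψ
        (fun i => (e _).injective (congrFun h (Sum.inl i)))
        (fun k => (e _).injective (congrFun h (Sum.inr k)))
    exact key _ (φ β') h1 h2
  have hle := Nat.card_le_card_of_injective code hinj
  rw [Nat.card_prod, Nat.card_fun, Nat.card_fun, Nat.card_fun, Nat.card_zmod] at hle
  simp only [Nat.card_eq_fintype_card (α := Fin _), Nat.card_eq_fintype_card (α := Sym2 _),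
    Nat.card_eq_fintype_card (α := Fin _ ⊕ Fin _), Fintype.card_sum, Sym2.card,
    Fintype.card_fin, ← pow_mul] at hle
  exact hle

/-! ### Optimising `d` and collecting error terms. -/

theorem two_twentySevenths_cube_ge (n d : ℕ) (hd : d ≤ n) :
    (((n - d) * (d + 1).choose 2 : ℕ) : ℝ) ≤ 2 / 27 * (n : ℝ) ^ 3 + (n : ℝ) ^ 2 := by
  have h1 : (d : ℝ) ≤ n := by exact_mod_cast hd
  have h0 : (0 : ℝ) ≤ d := d.cast_nonneg
  push_cast [Nat.cast_choose_two, Nat.cast_sub hd]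
  -- This product equals `4n³ - 27 d² (n - d)`; the double root is the maximum at `d = 2n/3`.
  have h3 : 0 ≤ (3 * (d : ℝ) - 2 * n) ^ 2 * (3 * d + n) := by positivity
  nlinarith [mul_nonneg h0 (sub_nonneg.2 h1)]

theorem two_twentySevenths_cube_le {n d r : ℕ} (hd : d = 2 * n / 3) (hr : d + r + 1 = n) :
    2 / 27 * (n : ℝ) ^ 3 - (n : ℝ) ^ 2 ≤ ((r * (d + 1).choose 2 : ℕ) : ℝ) := by
  have h1 : 2 * (n : ℝ) ≤ 3 * d + 2 := by
    have : 2 * n ≤ 3 * d + 2 := by omega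
    exact_mod_cast this
  have h2 : (n : ℝ) ≤ 3 * r + 3 := by
    have : n ≤ 3 * r + 3 := by omega
    exact_mod_cast this
  have hn : (1 : ℝ) ≤ n := by
    have : 1 ≤ n := by omega
    exact_mod_cast this
  have hr0 : (0 : ℝ) ≤ r := r.cast_nonneg
  push_cast [Nat.cast_choose_two]
  have h3 : (2 * (n : ℝ) - 2) * (2 * n + 1) ≤ 3 * d * (3 * d + 3) :=
    mul_le_mul (by linarith) (by linarith) (by linarith) (by positivity)
  have h4 : r * ((2 * (n : ℝ) - 2) * (2 * n + 1)) ≤ r * (3 * d * (3 * d + 3)) :=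
    mul_le_mul_of_nonneg_left h3 hr0
  have h5 : ((n : ℝ) - 3) * ((2 * (n : ℝ) - 2) * (2 * n + 1)) ≤
      3 * r * ((2 * (n : ℝ) - 2) * (2 * n + 1)) :=
    mul_le_mul_of_nonneg_right (by linarith) (mul_nonneg (by linarith) (by linarith))
  nlinarith

theorem rpow_eight_thirds {n : ℕ} (hn : n ≠ 0) :
    (n : ℝ) ^ (8 / 3 : ℝ) = (n : ℝ) ^ 2 * (n : ℝ) ^ (2 / 3 : ℝ) := by
  have hn0 : (0 : ℝ) < n := by exact_mod_cast Nat.pos_of_ne_zero hn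
  rw [← Real.rpow_natCast, ← Real.rpow_add hn0]
  norm_num

theorem numCommRings_le_rpow {p n : ℕ} (hp : p.Prime) (hn : 1 ≤ n) :
    (numCommRings (p ^ n) : ℝ) ≤
      (p : ℝ) ^ ((2 / 27 : ℝ) * (n : ℝ) ^ 3 + 20 * (n : ℝ) ^ (8 / 3 : ℝ)) := by
  set q := Nat.sqrt n + 1 with hq
  set E := ⌊2 / 27 * (n : ℝ) ^ 3 + (n : ℝ) ^ 2⌋₊ with hE
  have h := (finite_and_numCommRings_le (n := n) (q := q) (E := E) hp (Nat.succ_pos _)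
    (Nat.lt_succ_sqrt n).le
    fun d hd => Nat.le_floor (two_twentySevenths_cube_ge n d hd)).2
  have hnp : n + 1 ≤ p ^ n := n.lt_two_pow_self.trans_le (Nat.pow_le_pow_left hp.two_le n)
  have h' : numCommRings (p ^ n) ≤
      p ^ (n + n * n + (n + (n * n * (5 * q + 1) + (n + (n * n + (n * n + E)))))) := by
    refine h.trans ?_
    simp only [pow_add]
    gcongr
  have hp1 : (1 : ℝ) ≤ p := by exact_mod_cast hp.one_le
  calc (numCommRings (p ^ n) : ℝ) ≤
      (p : ℝ) ^ (n + n * n + (n + (n * n * (5 * q + 1) + (n + (n * n + (n * n + E)))))) := by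
        exact_mod_cast h'
    _ ≤ _ := by
      rw [← Real.rpow_natCast]
      refine Real.rpow_le_rpow_of_exponent_le hp1 ?_
      have hn1 : (1 : ℝ) ≤ n := by exact_mod_cast hn
      have hEle : (E : ℝ) ≤ 2 / 27 * (n : ℝ) ^ 3 + (n : ℝ) ^ 2 := Nat.floor_le (by positivity)
      have hw1 : 1 ≤ (n : ℝ) ^ (2 / 3 : ℝ) := Real.one_le_rpow hn1 (by norm_num)
      have hsqrt : (Nat.sqrt n : ℝ) ≤ (n : ℝ) ^ (2 / 3 : ℝ) := by
        refine Real.nat_sqrt_le_real_sqrt.trans ?_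
        rw [Real.sqrt_eq_rpow]
        exact Real.rpow_le_rpow_of_exponent_le hn1 (by norm_num)
      rw [rpow_eight_thirds (by omega)]
      set w := (n : ℝ) ^ (2 / 3 : ℝ)
      have hqw : (q : ℝ) ≤ 2 * w := by rw [hq]; push_cast; linarith
      have h1 : (n : ℝ) ^ 2 * q ≤ (n : ℝ) ^ 2 * (2 * w) :=
        mul_le_mul_of_nonneg_left hqw (by positivity)
      have h2 : (n : ℝ) ^ 2 * 1 ≤ (n : ℝ) ^ 2 * w :=
        mul_le_mul_of_nonneg_left hw1 (by positivity)
      have h3 : (n : ℝ) ≤ (n : ℝ) ^ 2 := by nlinarith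
      push_cast
      -- The error is at most `5n²q + 5n² + 3n`, hence at most `18 n² w`.
      nlinarith

theorem rpow_le_numCommRings {p n : ℕ} (hp : p.Prime) (hn : 1 ≤ n) :
    (p : ℝ) ^ ((2 / 27 : ℝ) * (n : ℝ) ^ 3 - 20 * (n : ℝ) ^ (8 / 3 : ℝ)) ≤
      (numCommRings (p ^ n) : ℝ) := by
  have hn1 : (1 : ℝ) ≤ n := by exact_mod_cast hn
  obtain ⟨r, hr⟩ : ∃ r, 2 * n / 3 + r + 1 = n := ⟨n - 1 - 2 * n / 3, by omega⟩
  set d := 2 * n / 3 with hd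
  -- Finiteness is needed because `Nat.card` of an infinite type is `0`.
  have hfin := (finite_and_numCommRings_le (n := n) hp (Nat.succ_pos _)
    (Nat.lt_succ_sqrt n).le
    fun d hd => Nat.le_floor (two_twentySevenths_cube_ge n d hd)).1
  have h := pow_le_numCommRings_mul (d := d) (r := r) hp (by rwa [hr])
  rw [hr] at h
  have h' : (p : ℝ) ^ (((r * (d + 1).choose 2 : ℕ) : ℝ)) ≤
      numCommRings (p ^ n) * (p : ℝ) ^ ((n * (d + r) : ℕ) : ℝ) := by
    rw [Real.rpow_natCast, Real.rpow_natCast]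
    exact_mod_cast h
  have hp0 : (0 : ℝ) < p := by exact_mod_cast hp.pos
  have hp1 : (1 : ℝ) ≤ p := by exact_mod_cast hp.one_le
  rw [← div_le_iff₀ (Real.rpow_pos_of_pos hp0 _), ← Real.rpow_sub hp0] at h'
  refine le_trans (Real.rpow_le_rpow_of_exponent_le hp1 ?_) h'
  have h1 := two_twentySevenths_cube_le hd hr
  have h2 : ((n * (d + r) : ℕ) : ℝ) ≤ (n : ℝ) ^ 2 := by
    rw [pow_two]
    exact_mod_cast Nat.mul_le_mul_left n (by omega : d + r ≤ n)
  have hw1 : 1 ≤ (n : ℝ) ^ (2 / 3 : ℝ) := Real.one_le_rpow hn1 (by norm_num)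
  rw [rpow_eight_thirds (by omega)]
  have h3 : (n : ℝ) ^ 2 * 1 ≤ (n : ℝ) ^ 2 * (n : ℝ) ^ (2 / 3 : ℝ) :=
    mul_le_mul_of_nonneg_left hw1 (by positivity)
  nlinarith

theorem numCommRings_one : numCommRings 1 = 1 := by
  rw [numCommRings, Nat.card_eq_one_iff_unique]
  refine ⟨⟨fun Q Q' => ?_⟩, ⟨Quotient.mk _ ⟨CommRingCat.of PUnit, by simp⟩⟩⟩
  induction Q, Q' using Quotient.inductionOn₂ with
  | _ R R' =>
    have := (Nat.card_eq_one_iff_unique.1 R.2).1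
    have := (Nat.card_eq_one_iff_unique.1 R'.2).1
    exact Quotient.sound ⟨{
      toFun := fun _ => 0
      invFun := fun _ => 0
      left_inv := fun _ => Subsingleton.elim _ _
      right_inv := fun _ => Subsingleton.elim _ _
      map_mul' := fun _ _ => Subsingleton.elim _ _
      map_add' := fun _ _ => Subsingleton.elim _ _ }⟩

theorem mainTheorem3 :
    ∃ C : ℝ, ∀ p : ℕ, p.Prime → ∀ n : ℕ,
      (p : ℝ) ^ ((2 / 27 : ℝ) * (n : ℝ) ^ 3 - C * (n : ℝ) ^ (8 / 3 : ℝ))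
          ≤ (numCommRings (p ^ n) : ℝ) ∧
        (numCommRings (p ^ n) : ℝ)
          ≤ (p : ℝ) ^ ((2 / 27 : ℝ) * (n : ℝ) ^ 3 + C * (n : ℝ) ^ (8 / 3 : ℝ)) := by
  refine ⟨20, fun p hp n => ?_⟩
  rcases Nat.eq_zero_or_pos n with rfl | hn
  · have h0 : (0 : ℝ) ^ (8 / 3 : ℝ) = 0 := Real.zero_rpow (by norm_num)
    simp [h0, numCommRings_one]
  · exact ⟨rpow_le_numCommRings hp hn, numCommRings_le_rpow hp hn⟩
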